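/- Let $a,b,c,d\in\mathbb{C}$ with $abcd\neq 0$, let $(w_t)_{t\ge 0}$ be real numbers such that $w_{t+1}+w_t=\kappa_1$ for all $t\ge 0$, where $\kappa_1\in\mathbb{R}$ does not depend on $t$, and suppose that the matrices $$U_t=\begin{pmatrix} a e^{iw_t} & b\\ c & d e^{-iw_t}\end{pmatrix}\qquad (t=0,1,2,\ldots)$$ are unitary. Let $P_t$ and $Q_t$ be obtained from $U_t$ by replacing its second, respectively first, row by zeros. Consider the quantum walk on $\mathbb{Z}$ with amplitudes $\psi_t(x)\in\mathbb{C}^2$ given by $\psi_0(0)={}^T[\alpha,\beta]$, where $|\alpha|^2+|\beta|^2=1$, $\psi_0(x)=0$ for $x\ne 0$, and $$\psi_{t+1}(x)=P_t\,\psi_t(x+1)+Q_t\,\psi_t(x-1),$$ and let $X_t$ be its position at time $t$, i.e. $P(X_t=x)=\|\psi_t(x)\|^2$. Put $R(k)=\mathrm{diag}(e^{ik},e^{-ik})$. Then $U=\begin{pmatrix} a&b\\c&d\end{pmatrix}$ is unitary and the walk reduces to a one-period walk: if $\varphi_t(x)$ denotes the amplitudes of the walk with the constant coin $U$ started at the origin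 in the state $R(w_0/2)\,{}^T[\alpha,\beta]={}^T[e^{iw_0/2}\alpha,e^{-iw_0/2}\beta]$, then $\psi_t(x)=e^{-i\kappa_1x/2}R(-w_t/2)\,\varphi_t(x)$ for all $t\ge 0$ and $x\in\mathbb{Z}$. Moreover, as $t\to\infty$, $X_t/t$ converges in distribution to a random variable $Z_1$ with probability density $$f_1(x)=f_K(x;a)\left\{1-\left(|\alpha|^2-|\beta|^2+\frac{a\alpha\,\overline{b\beta}\,e^{iw_0}+\overline{a\alpha}\,b\beta\,e^{-iw_0}}{|a|^2}\right)x\right\},$$ where $f_K(x;a)=\dfrac{\sqrt{1-|a|^2}}{\pi(1-x^2)\sqrt{|a|^2-x^2}}$ for $|x|<|a|$ and $f_K(x;a)=0$ otherwise. -/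

import Mathlib

open MeasureTheory Filter Topology

noncomputable section

namespace QuantumWalk

/-- The matrix `P` of the walk: the first row of the coin `U`; it drives the moves to the left. -/
def leftPart (U : Matrix (Fin 2) (Fin 2) ℂ) : Matrix (Fin 2) (Fin 2) ℂ :=
  !![U 0 0, U 0 1; 0, 0]

/-- The matrix `Q` of the walk: the second row of the coin `U`; it drives the moves to the right. -/
def rightPart (U : Matrix (Fin 2) (Fin 2) ℂ) : Matrix (Fin 2) (Fin 2) ℂ :=
  !![0, 0; U 1 0, U 1 1]

/-- The diagonal matrix `R(k) = diag(e^{ik}, e^{-ik})`. -/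
def R (k : ℝ) : Matrix (Fin 2) (Fin 2) ℂ :=
  !![Complex.exp (Complex.I * k), 0; 0, Complex.exp (-(Complex.I * k))]

/-- The amplitude `ψ_t(x)` of the walk on `ℤ` with the coin `U_t` at time `t`, started at the
origin with the coin state `φ`. -/
def amplitude (U : ℕ → Matrix (Fin 2) (Fin 2) ℂ) (φ : Fin 2 → ℂ) : ℕ → ℤ → Fin 2 → ℂ
  | 0, x => if x = 0 then φ else 0
  | t + 1, x =>
      (leftPart (U t)).mulVec (amplitude U φ t (x + 1)) +
        (rightPart (U t)).mulVec (amplitude U φ t (x - 1))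

/-- The squared Euclidean norm `⟨v|v⟩` of a vector of `ℂ²`. -/
def normSq (v : Fin 2 → ℂ) : ℝ := ‖v 0‖ ^ 2 + ‖v 1‖ ^ 2

lemma normSq_nonneg (v : Fin 2 → ℂ) : 0 ≤ normSq v := by
  unfold normSq; positivity

lemma ofReal_normSq (v : Fin 2 → ℂ) : ((normSq v : ℝ) : ℂ) = dotProduct (star v) v := by
  simp [normSq, dotProduct, Fin.sum_univ_two, ← Complex.conj_mul']

lemma normSq_unitary_mulVec (U : Matrix.unitaryGroup (Fin 2) ℂ) (v : Fin 2 → ℂ) :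
    normSq ((U : Matrix (Fin 2) (Fin 2) ℂ).mulVec v) = normSq v := by
  have h : star (U : Matrix (Fin 2) (Fin 2) ℂ) * (U : Matrix (Fin 2) (Fin 2) ℂ) = 1 :=
    Unitary.coe_star_mul_self U
  have : ((normSq ((U : Matrix (Fin 2) (Fin 2) ℂ).mulVec v) : ℝ) : ℂ) = (normSq v : ℝ) := by
    rw [ofReal_normSq, ofReal_normSq, Matrix.star_mulVec, Matrix.dotProduct_mulVec,
      Matrix.vecMul_vecMul, ← Matrix.star_eq_conjTranspose, h, Matrix.vecMul_one]
  exact_mod_cast this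

lemma tsum_normSq_amplitude (U : ℕ → Matrix.unitaryGroup (Fin 2) ℂ) (φ : Fin 2 → ℂ)
    (hφ : normSq φ = 1) (t : ℕ) :
    ∑' x : ℤ, ENNReal.ofReal
      (normSq (amplitude (fun s => (U s : Matrix (Fin 2) (Fin 2) ℂ)) φ t x)) = 1 := by
  induction t with
  | zero =>
    rw [tsum_eq_single (0 : ℤ)]
    · simp [amplitude, hφ]
    · intro x hx
      simp [amplitude, hx, normSq]
  | succ t ih =>
    set A := amplitude (fun s => (U s : Matrix (Fin 2) (Fin 2) ℂ)) φ t with hA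
    set M : Matrix (Fin 2) (Fin 2) ℂ := (U t : Matrix (Fin 2) (Fin 2) ℂ) with hM
    have h1 : ∀ x : ℤ, ENNReal.ofReal
        (normSq (amplitude (fun s => (U s : Matrix (Fin 2) (Fin 2) ℂ)) φ (t + 1) x)) =
        ENNReal.ofReal (‖M.mulVec (A (x + 1)) 0‖ ^ 2) +
          ENNReal.ofReal (‖M.mulVec (A (x - 1)) 1‖ ^ 2) := by
      intro x
      rw [← ENNReal.ofReal_add (by positivity) (by positivity)]
      simp [amplitude, normSq, leftPart, rightPart, Matrix.mulVec, dotProduct,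
        Fin.sum_univ_two, ← hA, ← hM]
    have h2 : ∀ x : ℤ, ENNReal.ofReal (normSq (A x)) =
        ENNReal.ofReal (‖M.mulVec (A x) 0‖ ^ 2) + ENNReal.ofReal (‖M.mulVec (A x) 1‖ ^ 2) := by
      intro x
      rw [← ENNReal.ofReal_add (by positivity) (by positivity),
        ← normSq_unitary_mulVec (U t) (A x)]
      rfl
    rw [← ih, tsum_congr h1, tsum_congr h2, ENNReal.tsum_add, ENNReal.tsum_add]
    congr 1
    · exact (Equiv.addRight (1 : ℤ)).tsum_eq
        (fun x => ENNReal.ofReal (‖M.mulVec (A x) 0‖ ^ 2))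
    · exact (Equiv.subRight (1 : ℤ)).tsum_eq
        (fun x => ENNReal.ofReal (‖M.mulVec (A x) 1‖ ^ 2))

/-- The distribution of the position `X_t` of the walker: `P(X_t = x) = ‖ψ_t(x)‖²`. -/
def positionPMF (U : ℕ → Matrix.unitaryGroup (Fin 2) ℂ) (φ : Fin 2 → ℂ) (hφ : normSq φ = 1)
    (t : ℕ) : PMF ℤ :=
  ⟨fun x => ENNReal.ofReal
      (normSq (amplitude (fun s => (U s : Matrix (Fin 2) (Fin 2) ℂ)) φ t x)),
    (tsum_normSq_amplitude U φ hφ t) ▸ ENNReal.summable.hasSum⟩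

/-- The function `f_K(x; a)`. -/
def konnoDensity (a : ℂ) (x : ℝ) : ℝ :=
  Set.indicator (Set.Ioo (-‖a‖) ‖a‖)
    (fun y => √(1 - ‖a‖ ^ 2) / (Real.pi * (1 - y ^ 2) * √(‖a‖ ^ 2 - y ^ 2))) x

/-- The function
`f_K(x; a) {1 - (|α|² - |β|² + (aα b̄β̄ e^{iw₀} + āᾱ bβ e^{-iw₀}) / |a|²) x}`.
The quotient is a real number (a sum of two conjugate numbers over a real one), so that
taking its real part only changes its type. -/
def limitDensity (a b α β : ℂ) (w₀ : ℝ) (x : ℝ) : ℝ :=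
  konnoDensity a x *
    (1 - (‖α‖ ^ 2 - ‖β‖ ^ 2 +
      ((a * α * star (b * β) * Complex.exp (Complex.I * w₀) +
        star (a * α) * (b * β) * Complex.exp (-(Complex.I * w₀))) / ((‖a‖ : ℂ) ^ 2)).re) * x)

end QuantumWalk

end

/-!
The coin `U_t` equals `R(w_t/2) U R(w_t/2)` with `U = [[a, b], [c, d]]`, and `R` is diagonal. The
factor `R(w_t/2)` cancels against the gauge factor `R(-w_t/2)` of the amplitudes at time `t`, and
the condition `w_{t+1} + w_t = κ₁` makes what is left the gauge factor at time `t + 1`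
(`amplitude_R_mul_mul_R`). The gauge factors do not change the position distribution, so only the
walk with the constant coin `U` remains, started in `v = R(w_0/2) (α, β)`.

Its amplitudes are studied through their Fourier transform, on which a step of the walk acts as
multiplication by `diag(e^{-ik}, e^{ik}) U`. Up to a global phase and a shift of `k` this matrix is
`V(k) = cos θ(k) + i sin θ(k) N(k)` with `θ(k) = arccos (|a| cos k)` and `N(k)` a Hermitian
involution, so that `V(k)ᵗ v = cos (tθ) v + i sin (tθ) N(k) v`, without any diagonalisation.
By Parseval's identity the characteristic function of `X_t / t` at `ξ` is the mean over a period of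
`⟨V(k)ᵗ v, V(k + ξ/t)ᵗ v⟩`. As `t → ∞`, `t (θ(k + ξ/t) - θ(k))` tends to `ξ h(k)`, where `h = θ'` is
the group velocity, and the integrand tends to `cos (ξh) + i sin (ξh) ⟨v, N(k) v⟩`
(`tendsto_star_rotation_dotProduct_rotation`). It is bounded, so the integrals converge.

The wave numbers `k` and `π - k` have the same group velocity, and averaging `⟨v, N v⟩` over the two
gives `-λ h(k)`, where `λ` is the coefficient of `x` in the limit density. The substitution
`x = h(k)` on `(-π/2, π/2)`, for which `f_K(h(k)) h'(k) = 1/π`, turns the limit into the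
characteristic function of the asserted density (`integral_limitIntegrand`). Lévy's convergence
theorem concludes. The limit density is nonnegative because `|a| |λ| ≤ 1`, by the Cauchy-Schwarz
inequality, and has mass one because the limit of the characteristic functions at `0` is `1`.
-/

namespace QuantumWalk

/-! ### The walk in Fourier space -/

lemma amplitude_eq_zero (U : ℕ → Matrix (Fin 2) (Fin 2) ℂ) (φ : Fin 2 → ℂ) :
    ∀ (t : ℕ) (x : ℤ), x ∉ Finset.Icc (-(t : ℤ)) t → amplitude U φ t x = 0
  | 0, x, hx => by
    have : x ≠ 0 := by rintro rfl; simp at hx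
    simp [amplitude, this]
  | t + 1, x, hx => by
    simp only [Finset.mem_Icc, Nat.cast_add, Nat.cast_one] at hx
    have h1 := amplitude_eq_zero U φ t (x + 1) (by simp only [Finset.mem_Icc]; lia)
    have h2 := amplitude_eq_zero U φ t (x - 1) (by simp only [Finset.mem_Icc]; lia)
    simp [amplitude, h1, h2]

/-- The Fourier transform `∑ₓ e^{ikx} ψ(x)` of a family of amplitudes; it is only used for finitely
supported families, where the sum is not a junk value. -/
noncomputable def fourierTransform (ψ : ℤ → Fin 2 → ℂ) (k : ℝ) (i : Fin 2) : ℂ :=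
  ∑' x : ℤ, Complex.exp (Complex.I * k * x) * ψ x i

/-- The coin in Fourier space: `diag(e^{-ik}, e^{ik}) U`. -/
noncomputable def fourierCoin (U : Matrix (Fin 2) (Fin 2) ℂ) (k : ℝ) : Matrix (Fin 2) (Fin 2) ℂ :=
  R (-k) * U

lemma fourierTransform_amplitude (U : ℕ → Matrix (Fin 2) (Fin 2) ℂ) (φ : Fin 2 → ℂ) (t : ℕ)
    (k : ℝ) (i : Fin 2) :
    fourierTransform (amplitude U φ t) k i =
      ∑ x ∈ Finset.Icc (-(t : ℤ)) t, Complex.exp (Complex.I * k * x) * amplitude U φ t x i :=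
  tsum_eq_sum fun x hx => by simp [amplitude_eq_zero U φ t x hx]

lemma summable_amplitude (U : ℕ → Matrix (Fin 2) (Fin 2) ℂ) (φ : Fin 2 → ℂ) (t : ℕ)
    (g : ℤ → ℂ) (i : Fin 2) : Summable fun x => g x * amplitude U φ t x i :=
  summable_of_ne_finset_zero (s := Finset.Icc (-(t : ℤ)) t) fun x hx => by
    simp [amplitude_eq_zero U φ t x hx]

lemma fourierTransform_amplitude_zero (U : ℕ → Matrix (Fin 2) (Fin 2) ℂ) (φ : Fin 2 → ℂ) (k : ℝ) :
    fourierTransform (amplitude U φ 0) k = φ := by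
  ext i
  rw [fourierTransform_amplitude]
  simp [amplitude]

lemma fourierTransform_amplitude_succ (U : ℕ → Matrix (Fin 2) (Fin 2) ℂ) (φ : Fin 2 → ℂ) (t : ℕ)
    (k : ℝ) :
    fourierTransform (amplitude U φ (t + 1)) k =
      (fourierCoin (U t) k).mulVec (fourierTransform (amplitude U φ t) k) := by
  have hS := summable_amplitude U φ t (fun x => Complex.exp (Complex.I * k * x))
  ext i
  fin_cases i
  · let g : ℤ → ℂ := fun y => Complex.exp (-(Complex.I * k)) * (U t 0 0 *
      (Complex.exp (Complex.I * k * y) * amplitude U φ t y 0) + U t 0 1 *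
      (Complex.exp (Complex.I * k * y) * amplitude U φ t y 1))
    have h (x : ℤ) : Complex.exp (Complex.I * k * x) * amplitude U φ (t + 1) x 0 =
        g (Equiv.addRight 1 x) := by
      have e : Complex.exp (Complex.I * k * x) = Complex.exp (-(Complex.I * k)) *
          Complex.exp (Complex.I * k * (x + 1 : ℤ)) := by
        rw [← Complex.exp_add]; congr 1; push_cast; ring
      simp only [amplitude, leftPart, rightPart, e]
      simp [dotProduct, Fin.sum_univ_two, g, -Int.cast_add, -Int.cast_sub]
      ring
    refine (tsum_congr h).trans ((Equiv.tsum_eq (Equiv.addRight 1) g).trans ?_)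
    simp only [g]
    rw [tsum_mul_left, ((hS 0).mul_left _).tsum_add ((hS 1).mul_left _), tsum_mul_left,
      tsum_mul_left]
    simp [fourierCoin, R, fourierTransform, Matrix.mul_apply, Matrix.mulVec, dotProduct,
      Fin.sum_univ_two]
    ring
  · let g : ℤ → ℂ := fun y => Complex.exp (Complex.I * k) * (U t 1 0 *
      (Complex.exp (Complex.I * k * y) * amplitude U φ t y 0) + U t 1 1 *
      (Complex.exp (Complex.I * k * y) * amplitude U φ t y 1))
    have h (x : ℤ) : Complex.exp (Complex.I * k * x) * amplitude U φ (t + 1) x 1 =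
        g (Equiv.subRight 1 x) := by
      have e : Complex.exp (Complex.I * k * x) = Complex.exp (Complex.I * k) *
          Complex.exp (Complex.I * k * (x - 1 : ℤ)) := by
        rw [← Complex.exp_add]; congr 1; push_cast; ring
      simp only [amplitude, leftPart, rightPart, e]
      simp [dotProduct, Fin.sum_univ_two, g, -Int.cast_add, -Int.cast_sub]
      ring
    refine (tsum_congr h).trans ((Equiv.tsum_eq (Equiv.subRight 1) g).trans ?_)
    simp only [g]
    rw [tsum_mul_left, ((hS 0).mul_left _).tsum_add ((hS 1).mul_left _), tsum_mul_left,
      tsum_mul_left]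
    simp [fourierCoin, R, fourierTransform, Matrix.mul_apply, Matrix.mulVec, dotProduct,
      Fin.sum_univ_two]
    ring

lemma continuous_fourierTransform_amplitude (U : ℕ → Matrix (Fin 2) (Fin 2) ℂ) (φ : Fin 2 → ℂ)
    (t : ℕ) : Continuous fun k => fourierTransform (amplitude U φ t) k := by
  refine continuous_pi fun i => ?_
  simp only [fourierTransform_amplitude]
  fun_prop

lemma integral_exp_int_mul (n : ℤ) :
    ∫ k in (-(Real.pi / 2))..(3 * Real.pi / 2), Complex.exp (Complex.I * k * n) =
      if n = 0 then 2 * Real.pi else 0 := by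
  split_ifs with h
  · subst h
    simp
    ring
  · have hc : Complex.I * n ≠ 0 := by simp [h]
    have : ∀ k : ℝ, Complex.exp (Complex.I * k * n) = Complex.exp (Complex.I * n * k) :=
      fun k => by congr 1; ring
    simp only [this]
    rw [integral_exp_mul_complex hc, Complex.ofReal_zero, div_eq_zero_iff, sub_eq_zero]
    left
    rw [Complex.exp_eq_exp_iff_exists_int]
    exact ⟨n, by push_cast; ring⟩

/-- Parseval's identity, with the period starting at `-π/2`. The shift `ξ` of one factor produces
the characteristic function of the position; the common shift `η` has no effect. -/
lemma integral_star_dotProduct_fourierTransform (U : ℕ → Matrix (Fin 2) (Fin 2) ℂ) (φ : Fin 2 → ℂ)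
    (t : ℕ) (η ξ : ℝ) :
    ∫ k in (-(Real.pi / 2))..(3 * Real.pi / 2),
      star (fourierTransform (amplitude U φ t) (k + η)) ⬝ᵥ
        fourierTransform (amplitude U φ t) (k + ξ + η) =
    2 * Real.pi * ∑ x ∈ Finset.Icc (-(t : ℤ)) t,
      (normSq (amplitude U φ t x) : ℂ) * Complex.exp (ξ * x * Complex.I) := by
  set A := amplitude U φ t with hA
  set S := Finset.Icc (-(t : ℤ)) t with hS
  have key (i : Fin 2) :
      ∫ k in (-(Real.pi / 2))..(3 * Real.pi / 2), star (fourierTransform A (k + η) i) *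
        fourierTransform A (k + ξ + η) i =
      2 * Real.pi * ∑ x ∈ S, (‖A x i‖ : ℂ) ^ 2 * Complex.exp (ξ * x * Complex.I) := by
    have h1 (k : ℝ) : star (fourierTransform A (k + η) i) * fourierTransform A (k + ξ + η) i =
        ∑ x ∈ S, ∑ y ∈ S, (Complex.exp (Complex.I * (η * (y - x) + ξ * y)) *
          (star (A x i) * A y i)) * Complex.exp (Complex.I * k * (y - x : ℤ)) := by
      rw [hA, fourierTransform_amplitude, fourierTransform_amplitude, ← hA, ← hS, star_sum,
        Finset.sum_mul_sum]
      refine Finset.sum_congr rfl fun x _ => Finset.sum_congr rfl fun y _ => ?_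
      have e : Complex.exp (Complex.I * (η * (y - x) + ξ * y)) *
          Complex.exp (Complex.I * k * (y - x : ℤ)) =
          star (Complex.exp (Complex.I * (k + η : ℝ) * x)) *
            Complex.exp (Complex.I * (k + ξ + η : ℝ) * y) := by
        rw [Complex.star_def, ← Complex.exp_conj, ← Complex.exp_add, ← Complex.exp_add]
        congr 1
        simp
        ring
      rw [star_mul, mul_right_comm _ _ (Complex.exp (Complex.I * k * _)), e]
      ring
    simp only [h1]
    rw [intervalIntegral.integral_finsetSum fun x _ => by
      apply Continuous.intervalIntegrable; fun_prop, Finset.mul_sum]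
    refine Finset.sum_congr rfl fun x hx => ?_
    rw [intervalIntegral.integral_finsetSum fun y _ => by
      apply Continuous.intervalIntegrable; fun_prop]
    simp only [intervalIntegral.integral_const_mul, integral_exp_int_mul]
    rw [Finset.sum_eq_single_of_mem x hx]
    · simp [Complex.conj_mul']
      ring_nf
    · intro y _ hy
      simp [sub_eq_zero, hy]
  have hc := continuous_fourierTransform_amplitude U φ t
  rw [← hA] at hc
  have hc' (i : Fin 2) : Continuous fun k => fourierTransform A k i := (continuous_apply i).comp hc
  simp only [dotProduct, Fin.sum_univ_two, Pi.star_apply]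
  rw [intervalIntegral.integral_add, key, key, ← mul_add, ← Finset.sum_add_distrib]
  · simp [normSq, add_mul]
  all_goals
    apply Continuous.intervalIntegrable
    exact (((hc' _).comp (by fun_prop : Continuous fun k : ℝ => k + η)).star).mul
      ((hc' _).comp (by fun_prop : Continuous fun k : ℝ => k + ξ + η))

/-! ### The group velocity and the spectral form of the coin -/

/-- The group velocity `h(k) = θ'(k)` of the walk, for the dispersion relation
`θ(k) = arccos (r cos k)`. -/
noncomputable def groupVelocity (r k : ℝ) : ℝ := r * Real.sin k / √(1 - (r * Real.cos k) ^ 2)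

/-- The Hermitian involution `N(k)` with `V(k) = cos θ(k) + i sin θ(k) N(k)`, where `V(k)` is
`standardCoin r q k` and `cos θ(k) = r cos k`. -/
noncomputable def coinAxis (r : ℝ) (q : ℂ) (k : ℝ) : Matrix (Fin 2) (Fin 2) ℂ :=
  !![-(groupVelocity r k : ℂ),
      -(Complex.I * Complex.exp (-(Complex.I * k)) * q) / √(1 - (r * Real.cos k) ^ 2);
    Complex.I * Complex.exp (Complex.I * k) * star q / √(1 - (r * Real.cos k) ^ 2),
      (groupVelocity r k : ℂ)]

/-- The Fourier-space coin in `SU(2)` with top row `e^{-ik} (r, q)`. -/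
noncomputable def standardCoin (r : ℝ) (q : ℂ) (k : ℝ) : Matrix (Fin 2) (Fin 2) ℂ :=
  !![r * Complex.exp (-(Complex.I * k)), q * Complex.exp (-(Complex.I * k));
    -(star q * Complex.exp (Complex.I * k)), r * Complex.exp (Complex.I * k)]

section

variable {r : ℝ} (hr0 : 0 < r) (hr1 : r < 1)

include hr0 hr1

lemma one_sub_sq_pos (k : ℝ) : 0 < 1 - (r * Real.cos k) ^ 2 := by
  rw [sub_pos, mul_pow]
  exact mul_lt_one_of_nonneg_of_lt_one_left (sq_nonneg r) (pow_lt_one₀ hr0.le hr1 two_ne_zero)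
    (Real.cos_sq_le_one k)

lemma hasDerivAt_arccos_mul_cos (k : ℝ) :
    HasDerivAt (fun k => Real.arccos (r * Real.cos k)) (groupVelocity r k) k := by
  have h := one_sub_sq_pos hr0 hr1 k
  have h1 : r * Real.cos k ≠ -1 := by intro e; rw [e] at h; norm_num at h
  have h2 : r * Real.cos k ≠ 1 := by intro e; rw [e] at h; norm_num at h
  refine ((Real.hasDerivAt_arccos h1 h2).comp k
    ((Real.hasDerivAt_cos k).const_mul r)).congr_deriv ?_
  rw [groupVelocity]
  ring

lemma cos_arccos_mul_cos (k : ℝ) : Real.cos (Real.arccos (r * Real.cos k)) = r * Real.cos k := by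
  have h := one_sub_sq_pos hr0 hr1 k
  exact Real.cos_arccos (by nlinarith) (by nlinarith)

lemma continuous_groupVelocity : Continuous (groupVelocity r) := by
  unfold groupVelocity
  refine Continuous.div (by fun_prop) (by fun_prop) fun k => ?_
  exact (Real.sqrt_pos.2 (one_sub_sq_pos hr0 hr1 k)).ne'

lemma continuous_coinAxis (q : ℂ) : Continuous (coinAxis r q) := by
  have hg := continuous_groupVelocity hr0 hr1
  have hS (k : ℝ) : (√(1 - (r * Real.cos k) ^ 2) : ℂ) ≠ 0 :=
    Complex.ofReal_ne_zero.2 (Real.sqrt_pos.2 (one_sub_sq_pos hr0 hr1 k)).ne'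
  refine continuous_matrix fun i j => ?_
  fin_cases i <;> fin_cases j <;> simp only [coinAxis] <;> simp
  · fun_prop
  · exact Continuous.div (by fun_prop) (by fun_prop) hS
  · exact Continuous.div (by fun_prop) (by fun_prop) hS
  · fun_prop

lemma groupVelocity_sq_add {q : ℂ} (hq : ‖q‖ ^ 2 = 1 - r ^ 2) (k : ℝ) :
    groupVelocity r k ^ 2 + ‖q‖ ^ 2 / √(1 - (r * Real.cos k) ^ 2) ^ 2 = 1 := by
  have h := one_sub_sq_pos hr0 hr1 k
  rw [groupVelocity, div_pow, ← add_div, hq, Real.sq_sqrt h.le, div_eq_one_iff_eq h.ne']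
  linear_combination r ^ 2 * Real.sin_sq_add_cos_sq k

lemma coinAxis_mul_self {q : ℂ} (hq : ‖q‖ ^ 2 = 1 - r ^ 2) (k : ℝ) :
    coinAxis r q k * coinAxis r q k = 1 := by
  have e : Complex.exp (Complex.I * k) * Complex.exp (-(Complex.I * k)) = 1 := by
    rw [← Complex.exp_add, add_neg_cancel, Complex.exp_zero]
  have h : (groupVelocity r k : ℂ) ^ 2 + star q * q / (√(1 - (r * Real.cos k) ^ 2) : ℂ) ^ 2 =
      1 := by
    rw [Complex.star_def, Complex.conj_mul']
    exact_mod_cast groupVelocity_sq_add hr0 hr1 hq k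
  have h2 : star q * q / (√(1 - (r * Real.cos k) ^ 2) : ℂ) ^ 2 =
    1 - (groupVelocity r k : ℂ) ^ 2 := by linear_combination h
  have hI := Complex.I_sq
  ext i j
  fin_cases i <;> fin_cases j <;>
    simp only [coinAxis, Matrix.mul_apply, Fin.sum_univ_two] <;> simp <;>
    try simp only [← Complex.star_def]
  · rw [show ∀ S : ℂ, -(Complex.I * Complex.exp (-(Complex.I * k)) * q) / S *
      (Complex.I * Complex.exp (Complex.I * k) * star q / S) =
      -(Complex.I ^ 2 * (Complex.exp (Complex.I * k) * Complex.exp (-(Complex.I * k))) *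
        (star q * q / S ^ 2)) from fun S => by ring, e, hI, h2]
    ring
  · ring
  · ring
  · rw [show ∀ S : ℂ, (Complex.I * Complex.exp (Complex.I * k) * star q / S) *
      (-(Complex.I * Complex.exp (-(Complex.I * k)) * q) / S)  =
      -(Complex.I ^ 2 * (Complex.exp (Complex.I * k) * Complex.exp (-(Complex.I * k))) *
        (star q * q / S ^ 2)) from fun S => by ring, e, hI, h2]
    ring

lemma standardCoin_eq (q : ℂ) (k : ℝ) :
    standardCoin r q k = (Real.cos (Real.arccos (r * Real.cos k)) : ℂ) • (1 : Matrix _ _ ℂ) +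
      (Complex.I * Real.sin (Real.arccos (r * Real.cos k))) • coinAxis r q k := by
  have hS : (√(1 - (r * Real.cos k) ^ 2) : ℂ) ≠ 0 :=
    Complex.ofReal_ne_zero.2 (Real.sqrt_pos.2 (one_sub_sq_pos hr0 hr1 k)).ne'
  have hI := Complex.I_sq
  have e1 : Complex.exp (Complex.I * k) = Complex.cos k + Complex.sin k * Complex.I := by
    rw [mul_comm, Complex.exp_mul_I]
  have e2 : Complex.exp (-(Complex.I * k)) = Complex.cos k - Complex.sin k * Complex.I := by
    rw [show -(Complex.I * (k : ℂ)) = (-k : ℂ) * Complex.I by ring, Complex.exp_mul_I,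
      Complex.cos_neg, Complex.sin_neg]
    ring
  rw [cos_arccos_mul_cos hr0 hr1, Real.sin_arccos]
  unfold standardCoin coinAxis groupVelocity
  generalize √(1 - (r * Real.cos k) ^ 2) = S at *
  ext i j
  fin_cases i <;> fin_cases j <;>
    simp only [e1, e2, Complex.ofReal_div, Complex.ofReal_mul] <;> simp <;> field_simp
  · ring
  · linear_combination (q * (Complex.cos k - Complex.I * Complex.sin k)) * hI
  · linear_combination (-(starRingEnd ℂ q) * (Complex.cos k + Complex.I * Complex.sin k)) * hI

end

lemma star_mulVec_coinAxis_dotProduct (r : ℝ) (q : ℂ) (k : ℝ) (v w : Fin 2 → ℂ) :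
    star ((coinAxis r q k).mulVec v) ⬝ᵥ w = star v ⬝ᵥ (coinAxis r q k).mulVec w := by
  have e1 : (starRingEnd ℂ) (Complex.exp (Complex.I * k)) = Complex.exp (-(Complex.I * k)) := by
    rw [← Complex.exp_conj]; simp
  have e2 : (starRingEnd ℂ) (Complex.exp (-(Complex.I * k))) = Complex.exp (Complex.I * k) := by
    rw [← Complex.exp_conj]; simp
  simp only [dotProduct, Fin.sum_univ_two, coinAxis, Matrix.mulVec, Pi.star_apply]
  simp [e1, e2]
  ring

/-! ### Powers of the coin and their ballistic limit -/

/-- The vector `V(k)ᵗ v`, written by de Moivre's formula as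
`cos (t θ(k)) v + i sin (t θ(k)) N(k) v`; the time `t` may be any real number. -/
noncomputable def rotation (r : ℝ) (q : ℂ) (v : Fin 2 → ℂ) (t k : ℝ) : Fin 2 → ℂ :=
  (Real.cos (t * Real.arccos (r * Real.cos k)) : ℂ) • v +
    (Complex.I * Real.sin (t * Real.arccos (r * Real.cos k))) • (coinAxis r q k).mulVec v

lemma rotation_succ {r : ℝ} (hr0 : 0 < r) (hr1 : r < 1) {q : ℂ} (hq : ‖q‖ ^ 2 = 1 - r ^ 2)
    (v : Fin 2 → ℂ) (t k : ℝ) :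
    rotation r q v (t + 1) k = (standardCoin r q k).mulVec (rotation r q v t k) := by
  rw [standardCoin_eq hr0 hr1, rotation, rotation]
  simp only [Matrix.add_mulVec, Matrix.mulVec_add, Matrix.smul_mulVec, Matrix.mulVec_smul,
    Matrix.one_mulVec, Matrix.mulVec_mulVec, Matrix.add_mul, Matrix.smul_mul, Matrix.one_mul,
    coinAxis_mul_self hr0 hr1 hq]
  rw [add_mul, one_mul, Real.cos_add, Real.sin_add]
  set c := Real.cos (t * Real.arccos (r * Real.cos k))
  set s := Real.sin (t * Real.arccos (r * Real.cos k))
  set c' := Real.cos (Real.arccos (r * Real.cos k))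
  set s' := Real.sin (Real.arccos (r * Real.cos k))
  have hI := Complex.I_sq
  ext i
  simp only [Pi.add_apply, Pi.smul_apply, smul_eq_mul]
  push_cast
  linear_combination (-(s * s' : ℂ) * v i) * hI

lemma star_rotation_dotProduct_rotation (r : ℝ) (q : ℂ) (v : Fin 2 → ℂ) (t k l : ℝ) :
    star (rotation r q v t k) ⬝ᵥ rotation r q v t l =
      Real.cos (t * Real.arccos (r * Real.cos k)) * Real.cos (t * Real.arccos (r * Real.cos l)) *
        (star v ⬝ᵥ v) +
      Complex.I * Real.cos (t * Real.arccos (r * Real.cos k)) *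
        Real.sin (t * Real.arccos (r * Real.cos l)) * (star v ⬝ᵥ (coinAxis r q l).mulVec v) -
      Complex.I * Real.sin (t * Real.arccos (r * Real.cos k)) *
        Real.cos (t * Real.arccos (r * Real.cos l)) * (star v ⬝ᵥ (coinAxis r q k).mulVec v) +
      Real.sin (t * Real.arccos (r * Real.cos k)) * Real.sin (t * Real.arccos (r * Real.cos l)) *
        (star v ⬝ᵥ (coinAxis r q k * coinAxis r q l).mulVec v) := by
  simp only [rotation, star_add, star_smul, add_dotProduct, dotProduct_add, smul_dotProduct,
    dotProduct_smul, star_mulVec_coinAxis_dotProduct, Matrix.mulVec_mulVec, smul_eq_mul,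
    Complex.star_def, map_mul, Complex.conj_ofReal, Complex.conj_I]
  linear_combination (-(Real.sin (t * Real.arccos (r * Real.cos k)) *
    Real.sin (t * Real.arccos (r * Real.cos l)) : ℂ) *
        (star v ⬝ᵥ (coinAxis r q k * coinAxis r q l).mulVec v)) * Complex.I_sq

/-- The integrand of the limiting characteristic function, `cos (ξh) + i sin (ξh) ⟨v, N(k) v⟩`. -/
noncomputable def limitIntegrand (r : ℝ) (q : ℂ) (v : Fin 2 → ℂ) (ξ k : ℝ) : ℂ :=
  Real.cos (ξ * groupVelocity r k) +
    Complex.I * Real.sin (ξ * groupVelocity r k) * (star v ⬝ᵥ (coinAxis r q k).mulVec v)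

lemma tendsto_mul_slope {f : ℝ → ℝ} {f' k : ℝ} (hf : HasDerivAt f f' k) (ξ : ℝ) :
    Tendsto (fun t : ℕ => (t : ℝ) * (f (k + ξ / t) - f k)) atTop (𝓝 (ξ * f')) := by
  have h : HasDerivAt (fun s => f (k + ξ * s)) (ξ * f') 0 := by
    have h2 : HasDerivAt (fun s => k + ξ * s) ξ 0 := by
      simpa using ((hasDerivAt_id (0 : ℝ)).const_mul ξ).const_add k
    have := HasDerivAt.comp (h₂ := f) (h₂' := f') (0 : ℝ) (by simpa using hf) h2
    rwa [mul_comm] at this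
  have h4 : Tendsto (fun t : ℕ => ((t : ℝ))⁻¹) atTop (𝓝[≠] 0) :=
    tendsto_nhdsWithin_iff.2 ⟨tendsto_inv_atTop_nhds_zero_nat, by
      filter_upwards [eventually_ne_atTop 0] with t ht
      simpa using ht⟩
  have h3 := (hasDerivAt_iff_tendsto_slope.1 h).comp h4
  refine h3.congr fun t => ?_
  simp [slope, div_eq_mul_inv]

section

variable {r : ℝ} (hr0 : 0 < r) (hr1 : r < 1) {q : ℂ} (hq : ‖q‖ ^ 2 = 1 - r ^ 2)
  {v : Fin 2 → ℂ} (hv : normSq v = 1)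

include hr0 hr1 hq hv

lemma normSq_rotation (t k : ℝ) : normSq (rotation r q v t k) = 1 := by
  have h1 : star v ⬝ᵥ v = 1 := by rw [← ofReal_normSq, hv]; simp
  have h : ((normSq (rotation r q v t k) : ℝ) : ℂ) = 1 := by
    rw [ofReal_normSq, star_rotation_dotProduct_rotation, coinAxis_mul_self hr0 hr1 hq,
      Matrix.one_mulVec, h1]
    have := Real.sin_sq_add_cos_sq (t * Real.arccos (r * Real.cos k))
    have h2 : (Real.sin (t * Real.arccos (r * Real.cos k)) : ℂ) ^ 2 +
      (Real.cos (t * Real.arccos (r * Real.cos k)) : ℂ) ^ 2 = 1 := by exact_mod_cast this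
    linear_combination h2
  exact_mod_cast h

lemma norm_star_rotation_dotProduct_rotation_le (t k l : ℝ) :
    ‖star (rotation r q v t k) ⬝ᵥ rotation r q v t l‖ ≤ 2 := by
  have hb (k : ℝ) (i : Fin 2) : ‖rotation r q v t k i‖ ≤ 1 := by
    have := normSq_rotation hr0 hr1 hq hv t k
    rw [normSq] at this
    fin_cases i <;> simp <;> nlinarith [sq_nonneg ‖rotation r q v t k 0‖,
      sq_nonneg ‖rotation r q v t k 1‖, norm_nonneg (rotation r q v t k 0),
      norm_nonneg (rotation r q v t k 1)]
  rw [dotProduct, Fin.sum_univ_two]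
  refine (norm_add_le _ _).trans ?_
  rw [norm_mul, norm_mul, Pi.star_apply, Pi.star_apply, norm_star, norm_star]
  have h0 := mul_le_one₀ (hb k 0) (norm_nonneg _) (hb l 0)
  have h1 := mul_le_one₀ (hb k 1) (norm_nonneg _) (hb l 1)
  linarith

lemma tendsto_star_rotation_dotProduct_rotation (ξ k : ℝ) :
    Tendsto (fun t : ℕ => star (rotation r q v t k) ⬝ᵥ rotation r q v t (k + ξ / t)) atTop
      (𝓝 (limitIntegrand r q v ξ k)) := by
  have hv1 : star v ⬝ᵥ v = 1 := by rw [← ofReal_normSq, hv]; simp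
  set θ : ℝ → ℝ := fun k => Real.arccos (r * Real.cos k) with hθ
  set m : ℝ → ℂ := fun l => star v ⬝ᵥ (coinAxis r q l).mulVec v with hm
  set p : ℝ → ℂ := fun l => star v ⬝ᵥ (coinAxis r q k * coinAxis r q l).mulVec v with hp
  have hN := continuous_coinAxis hr0 hr1 q
  have hmc : Continuous m := by
    exact continuous_const.dotProduct (hN.matrix_mulVec continuous_const)
  have hpc : Continuous p := by
    exact continuous_const.dotProduct ((continuous_const.mul hN).matrix_mulVec continuous_const)
  have hk : Tendsto (fun t : ℕ => k + ξ / (t : ℝ)) atTop (𝓝 k) := by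
    simpa using (tendsto_const_div_atTop_nhds_zero_nat ξ).const_add k
  have hpk : p k = 1 := by
    simp only [hp, coinAxis_mul_self hr0 hr1 hq, Matrix.one_mulVec, hv1]
  have hm0 : Tendsto (fun t : ℕ => m (k + ξ / t) - m k) atTop (𝓝 0) := by
    simpa using ((hmc.tendsto k).comp hk).sub_const (m k)
  have hp0 : Tendsto (fun t : ℕ => p (k + ξ / t) - 1) atTop (𝓝 0) := by
    simpa [hpk] using ((hpc.tendsto k).comp hk).sub_const 1
  have hθ0 := tendsto_mul_slope (hasDerivAt_arccos_mul_cos hr0 hr1 k) ξ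
  have hsc (x y : ℝ) : ‖(Complex.I * Real.cos x * Real.sin y : ℂ)‖ ≤ 1 := by
    rw [norm_mul, norm_mul, Complex.norm_I, one_mul, Complex.norm_real, Complex.norm_real]
    exact mul_le_one₀ (Real.abs_cos_le_one x) (norm_nonneg _) (Real.abs_sin_le_one y)
  have hss (x y : ℝ) : ‖(Real.sin x * Real.sin y : ℂ)‖ ≤ 1 := by
    rw [norm_mul, Complex.norm_real, Complex.norm_real]
    exact mul_le_one₀ (Real.abs_sin_le_one x) (norm_nonneg _) (Real.abs_sin_le_one y)
  -- replacing `N(k + ξ/t)` by `N(k)` leaves the angle difference formulas, with errors `h2`, `h3`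
  have h1 : Tendsto (fun t : ℕ => (Real.cos (t * (θ (k + ξ / t) - θ k)) : ℂ) +
      Complex.I * Real.sin (t * (θ (k + ξ / t) - θ k)) * m k) atTop
      (𝓝 (limitIntegrand r q v ξ k)) := by
    have hc : Continuous fun x : ℝ => (Real.cos x : ℂ) + Complex.I * Real.sin x * m k := by
      fun_prop
    exact (hc.tendsto _).comp hθ0
  have h2 : Tendsto (fun t : ℕ => (Complex.I * Real.cos (t * θ k) *
      Real.sin (t * θ (k + ξ / t)) : ℂ) * (m (k + ξ / t) - m k)) atTop (𝓝 0) :=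
    squeeze_zero_norm (fun t => by
      rw [norm_mul]
      exact mul_le_of_le_one_left (norm_nonneg _) (hsc _ _))
      (tendsto_zero_iff_norm_tendsto_zero.1 hm0)
  have h3 : Tendsto (fun t : ℕ => (Real.sin (t * θ k) *
      Real.sin (t * θ (k + ξ / t)) : ℂ) * (p (k + ξ / t) - 1)) atTop (𝓝 0) :=
    squeeze_zero_norm (fun t => by
      rw [norm_mul]
      exact mul_le_of_le_one_left (norm_nonneg _) (hss _ _))
      (tendsto_zero_iff_norm_tendsto_zero.1 hp0)
  have h4 := (h1.add h2).add h3
  rw [add_zero, add_zero] at h4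
  refine h4.congr fun t => ?_
  rw [star_rotation_dotProduct_rotation, hv1, mul_sub, Real.cos_sub, Real.sin_sub]
  push_cast
  simp only [hm, hp, hθ]
  ring

end

/-! ### The limit density -/

/-- The number `λ` in the limit density `f_K(x; a) (1 - λ x)` of the walk with constant coin started
in the state `v`. As in `limitDensity`, the real part is that of a real number. -/
noncomputable def velocityBias (a b : ℂ) (v : Fin 2 → ℂ) : ℝ :=
  ‖v 0‖ ^ 2 - ‖v 1‖ ^ 2 +
    ((a * v 0 * star (b * v 1) + star (a * v 0) * (b * v 1)) / ((‖a‖ : ℂ) ^ 2)).re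

lemma limitDensity_eq (a b α β : ℂ) (w : ℝ) (x : ℝ) :
    limitDensity a b α β w x =
      konnoDensity a x * (1 - velocityBias a b ((R (w / 2)).mulVec ![α, β]) * x) := by
  have e1 : (starRingEnd ℂ) (Complex.exp (Complex.I * (w / 2))) =
      Complex.exp (-(Complex.I * (w / 2))) := by
    rw [← Complex.exp_conj]; simp [Complex.conj_ofNat]
  have e2 : (starRingEnd ℂ) (Complex.exp (-(Complex.I * (w / 2)))) =
      Complex.exp (Complex.I * (w / 2)) := by
    rw [← Complex.exp_conj]; simp [Complex.conj_ofNat]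
  have e3 : Complex.exp (Complex.I * w) =
      Complex.exp (Complex.I * (w / 2)) * Complex.exp (Complex.I * (w / 2)) := by
    rw [← Complex.exp_add]; congr 1; ring
  have e4 : Complex.exp (-(Complex.I * w)) =
      Complex.exp (-(Complex.I * (w / 2))) * Complex.exp (-(Complex.I * (w / 2))) := by
    rw [← Complex.exp_add]; congr 1; ring
  have n1 : ‖Complex.exp (Complex.I * (w / 2))‖ = 1 := by
    rw [mul_comm]; exact_mod_cast Complex.norm_exp_ofReal_mul_I (w / 2)
  have n2 : ‖Complex.exp (-(Complex.I * (w / 2)))‖ = 1 := by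
    rw [Complex.exp_neg, norm_inv, n1, inv_one]
  have h0 : (R (w / 2)).mulVec ![α, β] 0 = Complex.exp (Complex.I * (w / 2)) * α := by
    simp [R, Matrix.mulVec, dotProduct, Fin.sum_univ_two]
  have h1 : (R (w / 2)).mulVec ![α, β] 1 = Complex.exp (-(Complex.I * (w / 2))) * β := by
    simp [R, Matrix.mulVec, dotProduct, Fin.sum_univ_two]
  rw [limitDensity, velocityBias, h0, h1, norm_mul, norm_mul, n1, n2, one_mul, one_mul, e3, e4]
  simp only [star_mul', Complex.star_def, e1, e2]
  congr 6
  ring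

lemma norm_mul_abs_velocityBias_le {a b : ℂ} (ha : a ≠ 0) (hab : ‖a‖ ^ 2 + ‖b‖ ^ 2 = 1)
    {v : Fin 2 → ℂ} (hv : normSq v = 1) : ‖a‖ * |velocityBias a b v| ≤ 1 := by
  have ha' : 0 < ‖a‖ := norm_pos_iff.2 ha
  rw [normSq] at hv
  set X := ((a * v 0 * star (b * v 1) + star (a * v 0) * (b * v 1)) / ((‖a‖ : ℂ) ^ 2)).re with hX
  have hXle : ‖a‖ * |X| ≤ ‖b‖ * (2 * ‖v 0‖ * ‖v 1‖) := by
    have h1 : |X| ≤ (‖a‖ * ‖v 0‖ * (‖b‖ * ‖v 1‖) + ‖a‖ * ‖v 0‖ * (‖b‖ * ‖v 1‖)) / ‖a‖ ^ 2 := by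
      refine (Complex.abs_re_le_norm _).trans ?_
      rw [norm_div, norm_pow, Complex.norm_real, norm_norm]
      gcongr
      refine (norm_add_le _ _).trans (le_of_eq ?_)
      simp only [norm_mul, norm_star]
    calc ‖a‖ * |X|
        ≤ ‖a‖ * ((‖a‖ * ‖v 0‖ * (‖b‖ * ‖v 1‖) + ‖a‖ * ‖v 0‖ * (‖b‖ * ‖v 1‖)) / ‖a‖ ^ 2) := by
          gcongr
      _ = _ := by field_simp; ring
  have h2 : ‖a‖ * |velocityBias a b v| ≤
      ‖a‖ * |‖v 0‖ ^ 2 - ‖v 1‖ ^ 2| + ‖b‖ * (2 * ‖v 0‖ * ‖v 1‖) := by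
    rw [velocityBias, ← hX]
    have := abs_add_le (‖v 0‖ ^ 2 - ‖v 1‖ ^ 2) X
    nlinarith
  refine h2.trans ?_
  -- Cauchy-Schwarz for `(‖a‖, ‖b‖)` and `(D, E)`, two unit vectors
  set D := |‖v 0‖ ^ 2 - ‖v 1‖ ^ 2|
  set E := 2 * ‖v 0‖ * ‖v 1‖
  have hDE : D ^ 2 + E ^ 2 = 1 := by
    rw [sq_abs]
    linear_combination (‖v 0‖ ^ 2 + ‖v 1‖ ^ 2 + 1) * hv
  nlinarith [sq_nonneg (‖a‖ - D), sq_nonneg (‖b‖ - E)]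

lemma konnoDensity_nonneg (a : ℂ) (ha1 : ‖a‖ < 1) (x : ℝ) : 0 ≤ konnoDensity a x := by
  rw [konnoDensity]
  refine Set.indicator_nonneg (fun y hy => ?_) x
  have : 0 < 1 - y ^ 2 := by nlinarith [hy.1, hy.2]
  positivity

lemma limit_factor_nonneg {a b : ℂ} (ha : a ≠ 0) (ha1 : ‖a‖ < 1) (hab : ‖a‖ ^ 2 + ‖b‖ ^ 2 = 1)
    {v : Fin 2 → ℂ} (hv : normSq v = 1) (x : ℝ) :
    0 ≤ konnoDensity a x * (1 - velocityBias a b v * x) := by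
  by_cases hx : x ∈ Set.Ioo (-‖a‖) ‖a‖
  · refine mul_nonneg (konnoDensity_nonneg a ha1 x) ?_
    have h1 := norm_mul_abs_velocityBias_le ha hab hv
    have h2 : |x| ≤ ‖a‖ := (abs_lt.2 hx).le
    have h3 : velocityBias a b v * x ≤ 1 :=
      calc velocityBias a b v * x ≤ |velocityBias a b v * x| := le_abs_self _
        _ = |x| * |velocityBias a b v| := by rw [abs_mul, mul_comm]
        _ ≤ ‖a‖ * |velocityBias a b v| := by gcongr
        _ ≤ 1 := h1
    linarith
  · rw [konnoDensity, Set.indicator_of_notMem hx, zero_mul]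

lemma measurable_konnoDensity (a : ℂ) : Measurable (konnoDensity a) :=
  Measurable.indicator (by fun_prop) measurableSet_Ioo

section

variable {r : ℝ} (hr0 : 0 < r) (hr1 : r < 1)

include hr0 hr1

lemma hasDerivAt_groupVelocity (k : ℝ) :
    HasDerivAt (groupVelocity r) ((1 - r ^ 2) * (r * Real.cos k) /
      ((1 - (r * Real.cos k) ^ 2) * √(1 - (r * Real.cos k) ^ 2))) k := by
  have h := one_sub_sq_pos hr0 hr1 k
  have hs := Real.sqrt_pos.2 h
  have hD : HasDerivAt (fun k => 1 - (r * Real.cos k) ^ 2)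
      (2 * (r * Real.cos k) * (r * Real.sin k)) k := by
    refine ((((Real.hasDerivAt_cos k).const_mul r).pow 2).const_sub 1).congr_deriv ?_
    push_cast
    ring
  refine (((Real.hasDerivAt_sin k).const_mul r).div (hD.sqrt h.ne') hs.ne').congr_deriv ?_
  have e := Real.sq_sqrt h.le
  have e2 := Real.sin_sq_add_cos_sq k
  generalize √(1 - (r * Real.cos k) ^ 2) = S at *
  rw [← e]
  field_simp
  rw [e]
  linear_combination (-r ^ 2 * Real.cos k) * e2

lemma strictMonoOn_groupVelocity :
    StrictMonoOn (groupVelocity r) (Set.Icc (-(Real.pi / 2)) (Real.pi / 2)) := by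
  refine strictMonoOn_of_deriv_pos (convex_Icc _ _)
    (continuous_groupVelocity hr0 hr1).continuousOn fun k hk => ?_
  rw [interior_Icc] at hk
  rw [(hasDerivAt_groupVelocity hr0 hr1 k).deriv]
  have h := one_sub_sq_pos hr0 hr1 k
  have h2 : 0 < 1 - r ^ 2 := by nlinarith
  have := Real.cos_pos_of_mem_Ioo hk
  positivity

lemma image_groupVelocity :
    groupVelocity r '' Set.Ioo (-(Real.pi / 2)) (Real.pi / 2) = Set.Ioo (-r) r := by
  have hp := Real.pi_pos
  have h1 : groupVelocity r (-(Real.pi / 2)) = -r := by simp [groupVelocity]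
  have h2 : groupVelocity r (Real.pi / 2) = r := by simp [groupVelocity]
  refine Set.Subset.antisymm ?_ ?_
  · rintro _ ⟨k, hk, rfl⟩
    have hm := strictMonoOn_groupVelocity hr0 hr1
    constructor
    · rw [← h1]
      exact hm (Set.left_mem_Icc.2 (by linarith)) (Set.Ioo_subset_Icc_self hk) hk.1
    · conv_rhs => rw [← h2]
      exact hm (Set.Ioo_subset_Icc_self hk) (Set.right_mem_Icc.2 (by linarith)) hk.2
  · have := intermediate_value_Ioo (by linarith : -(Real.pi / 2) ≤ Real.pi / 2)
      (continuous_groupVelocity hr0 hr1).continuousOn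
    rwa [h1, h2] at this

end

section

variable {a : ℂ} (ha : a ≠ 0) (ha1 : ‖a‖ < 1)

include ha ha1

/-- The identity `h'(k) f_K(h(k)) = 1/π`: Konno's density is the law of the group velocity at a
wave number uniformly distributed on `(-π/2, π/2)`. -/
lemma deriv_mul_konnoDensity_groupVelocity {k : ℝ}
    (hk : k ∈ Set.Ioo (-(Real.pi / 2)) (Real.pi / 2)) :
    |(1 - ‖a‖ ^ 2) * (‖a‖ * Real.cos k) /
      ((1 - (‖a‖ * Real.cos k) ^ 2) * √(1 - (‖a‖ * Real.cos k) ^ 2))| *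
        konnoDensity a (groupVelocity ‖a‖ k) = Real.pi⁻¹ := by
  have hr0 : 0 < ‖a‖ := norm_pos_iff.2 ha
  have hmem : groupVelocity ‖a‖ k ∈ Set.Ioo (-‖a‖) ‖a‖ := by
    rw [← image_groupVelocity hr0 ha1]
    exact Set.mem_image_of_mem _ hk
  rw [konnoDensity, Set.indicator_of_mem hmem]
  generalize ‖a‖ = r at *
  have h := one_sub_sq_pos hr0 ha1 k
  have hs := Real.sqrt_pos.2 h
  have hc := Real.cos_pos_of_mem_Ioo hk
  have e2 := Real.sin_sq_add_cos_sq k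
  have h2 : 0 < 1 - r ^ 2 := by nlinarith
  have hs2 := Real.sqrt_pos.2 h2
  have e := Real.sq_sqrt h.le
  have e3 := Real.sq_sqrt h2.le
  have hv : 1 - groupVelocity r k ^ 2 = √(1 - r ^ 2) ^ 2 / √(1 - (r * Real.cos k) ^ 2) ^ 2 := by
    rw [groupVelocity, div_pow, e3, eq_div_iff (by positivity), sub_mul,
      div_mul_cancel₀ _ (by positivity), e]
    linear_combination (-r ^ 2) * e2
  have hw : √(r ^ 2 - groupVelocity r k ^ 2) =
      r * Real.cos k * √(1 - r ^ 2) / √(1 - (r * Real.cos k) ^ 2) := by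
    rw [← Real.sqrt_sq (by positivity : 0 ≤ r * Real.cos k * √(1 - r ^ 2) /
      √(1 - (r * Real.cos k) ^ 2))]
    congr 1
    rw [groupVelocity, div_pow, div_pow, mul_pow _ (√(1 - r ^ 2)), e3, eq_div_iff (by positivity),
      sub_mul, div_mul_cancel₀ _ (by positivity), e]
    linear_combination (-r ^ 2) * e2
  rw [hv, hw, abs_of_pos (by positivity)]
  nth_rw 1 [← e]
  nth_rw 1 [← e3]
  generalize √(1 - (r * Real.cos k) ^ 2) = S at *
  generalize √(1 - r ^ 2) = T at *
  field_simp

variable {E : Type*} [NormedAddCommGroup E] [NormedSpace ℝ E]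

lemma integral_konnoDensity_smul (g : ℝ → E) :
    ∫ x, konnoDensity a x • g x =
      Real.pi⁻¹ • ∫ k in (-(Real.pi / 2))..(Real.pi / 2), g (groupVelocity ‖a‖ k) := by
  have hr0 : 0 < ‖a‖ := norm_pos_iff.2 ha
  have hp := Real.pi_pos
  have h1 : ∫ x, konnoDensity a x • g x = ∫ x in Set.Ioo (-‖a‖) ‖a‖, konnoDensity a x • g x := by
    refine (setIntegral_eq_integral_of_forall_compl_eq_zero fun x hx => ?_).symm
    rw [konnoDensity, Set.indicator_of_notMem hx, zero_smul]
  rw [h1, ← image_groupVelocity hr0 ha1, integral_image_eq_integral_abs_deriv_smul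
    measurableSet_Ioo (fun k _ => (hasDerivAt_groupVelocity hr0 ha1 k).hasDerivWithinAt)
    ((strictMonoOn_groupVelocity hr0 ha1).injOn.mono Set.Ioo_subset_Icc_self),
    setIntegral_congr_fun (g := fun k => Real.pi⁻¹ • g (groupVelocity ‖a‖ k)) measurableSet_Ioo
      (fun k hk => by
        simp only
        rw [smul_smul, deriv_mul_konnoDensity_groupVelocity ha ha1 hk]),
    integral_smul, ← integral_Ioc_eq_integral_Ioo, intervalIntegral.integral_of_le (by linarith)]

lemma integrable_konnoDensity_smul {g : ℝ → E} (hg : Continuous g) :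
    Integrable fun x => konnoDensity a x • g x := by
  have hr0 : 0 < ‖a‖ := norm_pos_iff.2 ha
  have h1 : IntegrableOn (fun x => konnoDensity a x • g x) (Set.Ioo (-‖a‖) ‖a‖) := by
    rw [← image_groupVelocity hr0 ha1, integrableOn_image_iff_integrableOn_abs_deriv_smul
      measurableSet_Ioo (fun k _ => (hasDerivAt_groupVelocity hr0 ha1 k).hasDerivWithinAt)
      ((strictMonoOn_groupVelocity hr0 ha1).injOn.mono Set.Ioo_subset_Icc_self)]
    refine IntegrableOn.congr_fun (f := fun k => Real.pi⁻¹ • g (groupVelocity ‖a‖ k)) ?_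
      (fun k hk => by
        simp only
        rw [smul_smul, deriv_mul_konnoDensity_groupVelocity ha ha1 hk]) measurableSet_Ioo
    have hc : Continuous fun k => Real.pi⁻¹ • g (groupVelocity ‖a‖ k) :=
      (hg.comp (continuous_groupVelocity hr0 ha1)).const_smul _
    exact (hc.integrableOn_Icc (a := -(Real.pi / 2)) (b := Real.pi / 2)).mono_set
      Set.Ioo_subset_Icc_self
  refine (integrableOn_iff_integrable_of_support_subset fun x hx => ?_).1 h1
  by_contra hx'
  exact hx (by simp only [konnoDensity, Set.indicator_of_notMem hx', zero_smul])

end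

/-! ### The limit of the characteristic functions -/

lemma groupVelocity_pi_sub (r k : ℝ) : groupVelocity r (Real.pi - k) = groupVelocity r k := by
  simp [groupVelocity, Real.sin_pi_sub, Real.cos_pi_sub]

lemma groupVelocity_neg (r k : ℝ) : groupVelocity r (-k) = -groupVelocity r k := by
  simp [groupVelocity, neg_div]

/-- The wave numbers `k` and `π - k` have the same group velocity; averaging over the two leaves
a quantity that depends on `k` through the group velocity only. -/
lemma coinAxis_add_coinAxis_pi_sub {a : ℂ} (ha : a ≠ 0) (b : ℂ) (v : Fin 2 → ℂ) (k : ℝ) :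
    star v ⬝ᵥ (coinAxis ‖a‖ (star a * b / ‖a‖) k).mulVec v +
      star v ⬝ᵥ (coinAxis ‖a‖ (star a * b / ‖a‖) (Real.pi - k)).mulVec v =
    -(2 * velocityBias a b v * groupVelocity ‖a‖ k : ℝ) := by
  have hr0 : (‖a‖ : ℂ) ≠ 0 := by simpa using ha
  have e1 : Complex.exp (Complex.I * k) = Complex.cos k + Complex.sin k * Complex.I := by
    rw [mul_comm, Complex.exp_mul_I]
  have e2 : Complex.exp (-(Complex.I * k)) = Complex.cos k - Complex.sin k * Complex.I := by
    rw [show -(Complex.I * (k : ℂ)) = (-k : ℂ) * Complex.I by ring, Complex.exp_mul_I,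
      Complex.cos_neg, Complex.sin_neg]
    ring
  have e3 : Complex.exp (Complex.I * (Real.pi - k)) =
      -(Complex.cos k - Complex.sin k * Complex.I) := by
    rw [← e2, show Complex.I * (Real.pi - k : ℂ) = -(Complex.I * k) + Real.pi * Complex.I by ring,
      Complex.exp_add, Complex.exp_pi_mul_I]
    ring
  have e4 : Complex.exp (-(Complex.I * (Real.pi - k))) =
      -(Complex.cos k + Complex.sin k * Complex.I) := by
    rw [← e1, show -(Complex.I * (Real.pi - k : ℂ)) = (Complex.I * k) - Real.pi * Complex.I by ring,
      Complex.exp_sub, Complex.exp_pi_mul_I]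
    ring
  have hbias : (velocityBias a b v : ℂ) = star (v 0) * v 0 - star (v 1) * v 1 +
      (a * v 0 * star (b * v 1) + star (a * v 0) * (b * v 1)) / ((‖a‖ : ℂ) ^ 2) := by
    have hre : ((((a * v 0 * star (b * v 1) + star (a * v 0) * (b * v 1)) /
        ((‖a‖ : ℂ) ^ 2)).re : ℝ) : ℂ) =
        (a * v 0 * star (b * v 1) + star (a * v 0) * (b * v 1)) / ((‖a‖ : ℂ) ^ 2) := by
      rw [← Complex.conj_eq_iff_re]
      simp
      ring
    rw [velocityBias, Complex.ofReal_add, hre]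
    simp [Complex.conj_mul']
  rw [Complex.ofReal_mul, Complex.ofReal_mul, hbias]
  simp only [dotProduct, Fin.sum_univ_two, coinAxis, Matrix.mulVec, Pi.star_apply,
    groupVelocity_pi_sub, Real.cos_pi_sub, mul_neg, neg_sq]
  simp only [Complex.ofReal_sub, groupVelocity, Complex.ofReal_div, Complex.ofReal_mul,
    e1, e2, e3, e4]
  have hI := Complex.I_sq
  generalize √(1 - (‖a‖ * Real.cos k) ^ 2) = S at *
  simp
  field_simp
  linear_combination (2 * Complex.sin k * ((starRingEnd ℂ) a * b * (starRingEnd ℂ) (v 0) * v 1 +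
    a * (starRingEnd ℂ) b * v 0 * (starRingEnd ℂ) (v 1)) / S) * hI

/-- The limit of the characteristic functions is the characteristic function of the limit density.
The part of the integral over `(π/2, 3π/2)` is folded onto `(-π/2, π/2)`, where the group velocity
is injective. -/
lemma integral_limitIntegrand {a : ℂ} (ha : a ≠ 0) (ha1 : ‖a‖ < 1) (b : ℂ) (v : Fin 2 → ℂ)
    (ξ : ℝ) :
    ∫ k in (-(Real.pi / 2))..(3 * Real.pi / 2),
      limitIntegrand ‖a‖ (star a * b / ‖a‖) v ξ k =
    2 * Real.pi * ∫ x, (konnoDensity a x * (1 - velocityBias a b v * x)) •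
      Complex.exp (ξ * x * Complex.I) := by
  have hr0 : 0 < ‖a‖ := norm_pos_iff.2 ha
  have hN := continuous_coinAxis hr0 ha1 (star a * b / ‖a‖)
  have hg := continuous_groupVelocity hr0 ha1
  have hc : Continuous (limitIntegrand ‖a‖ (star a * b / ‖a‖) v ξ) := by
    have hmc : Continuous fun k => star v ⬝ᵥ (coinAxis ‖a‖ (star a * b / ‖a‖) k).mulVec v :=
      continuous_const.dotProduct (hN.matrix_mulVec continuous_const)
    unfold limitIntegrand
    fun_prop
  set L := velocityBias a b v
  set h := groupVelocity ‖a‖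
  set f := limitIntegrand ‖a‖ (star a * b / ‖a‖) v ξ with hf
  -- the part of `(1 - L h) e^{iξh}` that is odd in `k`
  set H : ℝ → ℂ := fun k => Complex.I * Real.sin (ξ * h k) - L * h k * Real.cos (ξ * h k) with hH
  have hHc : Continuous H := by fun_prop
  have hodd : ∫ k in (-(Real.pi / 2))..(Real.pi / 2), H k = 0 := by
    have h1 := intervalIntegral.integral_comp_neg (a := -(Real.pi / 2)) (b := Real.pi / 2) H
    rw [neg_neg] at h1
    have h2 (k : ℝ) : H (-k) = -H k := by
      simp only [hH, h, groupVelocity_neg, mul_neg, Real.sin_neg, Real.cos_neg]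
      push_cast
      ring
    simp only [h2, intervalIntegral.integral_neg] at h1
    exact self_eq_neg.1 h1.symm
  have hsum (k : ℝ) : f k + f (Real.pi - k) =
      2 * ((1 - L * h k) • Complex.exp (ξ * h k * Complex.I) - H k) := by
    have := coinAxis_add_coinAxis_pi_sub ha b v k
    simp only [hf, limitIntegrand, groupVelocity_pi_sub]
    have e : Complex.exp (ξ * h k * Complex.I) =
        (Real.cos (ξ * h k) : ℂ) + (Real.sin (ξ * h k) : ℂ) * Complex.I := by
      rw [Complex.exp_mul_I]; push_cast; rfl
    rw [e, Complex.real_smul, hH]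
    push_cast at this ⊢
    linear_combination (Complex.I * Complex.sin (ξ * h k)) * this
  have hc' : Continuous fun k => f (Real.pi - k) := hc.comp (by fun_prop)
  have hsplit : ∫ k in (-(Real.pi / 2))..(3 * Real.pi / 2), f k =
      ∫ k in (-(Real.pi / 2))..(Real.pi / 2), (f k + f (Real.pi - k)) := by
    rw [← intervalIntegral.integral_add_adjacent_intervals (b := Real.pi / 2)
      (hc.intervalIntegrable _ _) (hc.intervalIntegrable _ _),
      intervalIntegral.integral_add (hc.intervalIntegrable _ _)
        (hc'.intervalIntegrable _ _),
      intervalIntegral.integral_comp_sub_left]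
    congr 2 <;> ring
  have hk : _ = Real.pi⁻¹ • ∫ k in (-(Real.pi / 2))..(Real.pi / 2),
      (1 - L * h k) • Complex.exp (ξ * h k * Complex.I) := integral_konnoDensity_smul ha ha1
    (fun x => (1 - L * x) • Complex.exp (ξ * x * Complex.I))
  simp only [mul_smul]
  rw [hk, hsplit]
  simp only [hsum]
  rw [intervalIntegral.integral_const_mul, intervalIntegral.integral_sub, hodd, sub_zero,
    Complex.real_smul]
  · have := Real.pi_ne_zero
    rw [← mul_assoc]
    congr 1
    push_cast
    field_simp
  · apply Continuous.intervalIntegrable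
    fun_prop
  · exact hHc.intervalIntegrable _ _

/-! ### Reduction to a constant coin -/

lemma R_mul_R (k l : ℝ) : R k * R l = R (k + l) := by
  ext i j
  fin_cases i <;> fin_cases j <;>
    simp [R, Matrix.mul_apply, Fin.sum_univ_two, ← Complex.exp_add] <;> ring_nf

lemma R_zero : R 0 = 1 := by
  ext i j
  fin_cases i <;> fin_cases j <;> simp [R]

lemma star_R (k : ℝ) : star (R k) = R (-k) := by
  ext i j
  fin_cases i <;> fin_cases j <;> simp [R, ← Complex.exp_conj]

lemma R_mem_unitaryGroup (k : ℝ) : R k ∈ Matrix.unitaryGroup (Fin 2) ℂ := by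
  rw [Matrix.mem_unitaryGroup_iff, star_R, R_mul_R, add_neg_cancel, R_zero]

/-- The coin with phase `w` is the phase-free coin with the rotation `R(w/2)` on both sides. -/
lemma coin_eq_R_mul_mul_R (a b c d : ℂ) (w : ℝ) :
    !![a * Complex.exp (Complex.I * w), b; c, d * Complex.exp (-(Complex.I * w))] =
      R (w / 2) * !![a, b; c, d] * R (w / 2) := by
  have e3 : Complex.exp (Complex.I * w) =
      Complex.exp (Complex.I * (w / 2)) * Complex.exp (Complex.I * (w / 2)) := by
    rw [← Complex.exp_add]; congr 1; ring
  have e4 : Complex.exp (-(Complex.I * w)) =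
      Complex.exp (-(Complex.I * (w / 2))) * Complex.exp (-(Complex.I * (w / 2))) := by
    rw [← Complex.exp_add]; congr 1; ring
  have e5 : Complex.exp (Complex.I * (w / 2)) * Complex.exp (-(Complex.I * (w / 2))) = 1 := by
    rw [← Complex.exp_add, add_neg_cancel, Complex.exp_zero]
  rw [e3, e4]
  ext i j
  fin_cases i <;> fin_cases j <;> simp [R, Matrix.mul_apply, Fin.sum_univ_two]
  · ring
  · linear_combination (-b) * e5
  · linear_combination (-c) * e5
  · ring

lemma leftPart_R_mul_mul_R (M : Matrix (Fin 2) (Fin 2) ℂ) (k : ℝ) :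
    leftPart (R k * M * R k) = R k * leftPart M * R k := by
  ext i j
  fin_cases i <;> fin_cases j <;>
    simp [R, leftPart, Matrix.vecMul, dotProduct, Matrix.mul_apply, Fin.sum_univ_two]

lemma rightPart_R_mul_mul_R (M : Matrix (Fin 2) (Fin 2) ℂ) (k : ℝ) :
    rightPart (R k * M * R k) = R k * rightPart M * R k := by
  ext i j
  fin_cases i <;> fin_cases j <;>
    simp [R, rightPart, Matrix.vecMul, dotProduct, Matrix.mul_apply, Fin.sum_univ_two]

/-- On vectors with vanishing second component the rotation `R(-k)` is the scalar `e^{-ik}`. -/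
lemma exp_smul_R_mulVec_leftPart (M : Matrix (Fin 2) (Fin 2) ℂ) (k l : ℝ) (v : Fin 2 → ℂ) :
    Complex.exp (-(Complex.I * k)) • (R l).mulVec ((leftPart M).mulVec v) =
      (R (l - k)).mulVec ((leftPart M).mulVec v) := by
  have e : Complex.exp (Complex.I * (l - k)) =
      Complex.exp (-(Complex.I * k)) * Complex.exp (Complex.I * l) := by
    rw [← Complex.exp_add]; congr 1; ring
  ext i
  fin_cases i <;> simp [R, leftPart, Matrix.mulVec, dotProduct, Fin.sum_univ_two, e]
  ring

/-- On vectors with vanishing first component the rotation `R(-k)` is the scalar `e^{ik}`. -/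
lemma exp_smul_R_mulVec_rightPart (M : Matrix (Fin 2) (Fin 2) ℂ) (k l : ℝ) (v : Fin 2 → ℂ) :
    Complex.exp (Complex.I * k) • (R l).mulVec ((rightPart M).mulVec v) =
      (R (l - k)).mulVec ((rightPart M).mulVec v) := by
  have e : Complex.exp (-(Complex.I * (l - k))) =
      Complex.exp (Complex.I * k) * Complex.exp (-(Complex.I * l)) := by
    rw [← Complex.exp_add]; congr 1; ring
  ext i
  fin_cases i <;> simp [R, rightPart, Matrix.mulVec, dotProduct, Fin.sum_univ_two, e]
  ring

/-- If the phases satisfy `w_{t+1} + w_t = κ`, the walk with coins `R(w_t/2) M R(w_t/2)` is a gauge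
transform of the walk with the constant coin `M`. -/
lemma amplitude_R_mul_mul_R (M : Matrix (Fin 2) (Fin 2) ℂ) (w : ℕ → ℝ) (κ : ℝ)
    (hw : ∀ t, w (t + 1) + w t = κ) (φ : Fin 2 → ℂ) (t : ℕ) (x : ℤ) :
    amplitude (fun s => R (w s / 2) * M * R (w s / 2)) φ t x =
      Complex.exp (-(Complex.I * κ * x / 2)) •
        (R (-(w t / 2))).mulVec (amplitude (fun _ => M) ((R (w 0 / 2)).mulVec φ) t x) := by
  induction t generalizing x with
  | zero =>
    by_cases hx : x = 0
    · have h : (R (-(w 0 / 2))).mulVec ((R (w 0 / 2)).mulVec φ) = φ := by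
        rw [Matrix.mulVec_mulVec, R_mul_R, neg_add_cancel, R_zero, Matrix.one_mulVec]
      simp only [amplitude, hx, if_true, h]
      simp
    · simp [amplitude, hx]
  | succ t ih =>
    have hwt : -(w (t + 1) / 2) = w t / 2 - κ / 2 := by
      rw [← hw t]; ring
    have e1 : Complex.exp (-(Complex.I * κ * (x + 1 : ℤ) / 2)) =
        Complex.exp (-(Complex.I * κ * x / 2)) * Complex.exp (-(Complex.I * (κ / 2 : ℝ))) := by
      rw [← Complex.exp_add]; congr 1; push_cast; ring
    have e2 : Complex.exp (-(Complex.I * κ * (x - 1 : ℤ) / 2)) =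
        Complex.exp (-(Complex.I * κ * x / 2)) * Complex.exp (Complex.I * (κ / 2 : ℝ)) := by
      rw [← Complex.exp_add]; congr 1; push_cast; ring
    have hR (v : Fin 2 → ℂ) : (R (w t / 2)).mulVec ((R (-(w t / 2))).mulVec v) = v := by
      rw [Matrix.mulVec_mulVec, R_mul_R, add_neg_cancel, R_zero, Matrix.one_mulVec]
    simp only [amplitude]
    rw [ih, ih, leftPart_R_mul_mul_R, rightPart_R_mul_mul_R, e1, e2, hwt]
    simp only [← Matrix.mulVec_mulVec, Matrix.mulVec_smul, hR, mul_smul, Matrix.mulVec_add,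
      exp_smul_R_mulVec_leftPart, exp_smul_R_mulVec_rightPart, smul_add]

lemma normSq_smul (c : ℂ) (v : Fin 2 → ℂ) : normSq (c • v) = ‖c‖ ^ 2 * normSq v := by
  simp [normSq, mul_pow, mul_add]

lemma normSq_R_mulVec (k : ℝ) (v : Fin 2 → ℂ) : normSq ((R k).mulVec v) = normSq v :=
  normSq_unitary_mulVec ⟨R k, R_mem_unitaryGroup k⟩ v

/-! ### The walk with a constant unitary coin -/

lemma norm_sq_add_norm_sq_of_mem_unitaryGroup {a b c d : ℂ}
    (hM : !![a, b; c, d] ∈ Matrix.unitaryGroup (Fin 2) ℂ) : ‖a‖ ^ 2 + ‖b‖ ^ 2 = 1 := by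
  have h := congr_fun₂ (Matrix.mem_unitaryGroup_iff.1 hM) 0 0
  simp [Matrix.mul_apply, Fin.sum_univ_two, Complex.mul_conj'] at h
  exact_mod_cast h

lemma adjugate_eq_det_smul_star {n : Type*} [Fintype n] [DecidableEq n] {M : Matrix n n ℂ}
    (hM : M ∈ Matrix.unitaryGroup n ℂ) : M.adjugate = M.det • star M := by
  calc M.adjugate = M.adjugate * (M * star M) := by
        rw [Matrix.mem_unitaryGroup_iff.1 hM, Matrix.mul_one]
    _ = M.det • star M := by
        rw [← Matrix.mul_assoc, Matrix.adjugate_mul, Matrix.smul_mul, Matrix.one_mul]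

/-- A unitary coin is, in Fourier space, a special unitary coin in standard form up to a global
phase and a shift of the wave number. -/
lemma exists_fourierCoin_eq_smul_standardCoin {a b c d : ℂ} (ha : a ≠ 0)
    (hM : !![a, b; c, d] ∈ Matrix.unitaryGroup (Fin 2) ℂ) :
    ∃ (s : ℂ) (η : ℝ), ‖s‖ = 1 ∧ ∀ k, fourierCoin !![a, b; c, d] (k + η) =
      s • standardCoin ‖a‖ (star a * b / ‖a‖) k := by
  have hr : (‖a‖ : ℂ) ≠ 0 := by simpa using ha
  have haa : star a * a = (‖a‖ : ℂ) ^ 2 := Complex.conj_mul' a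
  -- `s` is a square root of the determinant; the adjugate expresses the second row of the coin by
  -- the first, and the shift `η` is the argument of `u = a / (s ‖a‖)`
  obtain ⟨s, hs⟩ := IsAlgClosed.exists_eq_mul_self (Matrix.det !![a, b; c, d])
  have hs1 : ‖s‖ = 1 := by
    have h := (Unitary.mem_iff.1 (Matrix.det_of_mem_unitary hM)).1
    rw [Complex.star_def, Complex.conj_mul', hs, norm_mul] at h
    have h' : (‖s‖ * ‖s‖) ^ 2 = 1 := by exact_mod_cast h
    refine (pow_eq_one_iff_of_nonneg (norm_nonneg s) four_ne_zero).1 ?_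
    linear_combination h'
  have hs0 : s ≠ 0 := by rintro rfl; simp at hs1
  have hadj := adjugate_eq_det_smul_star hM
  rw [hs, Matrix.adjugate_fin_two_of] at hadj
  have hd : d = s * s * star a := by simpa using congr_fun₂ hadj 0 0
  have hc : -c = s * s * star b := by simpa using congr_fun₂ hadj 1 0
  set u : ℂ := a / (s * ‖a‖) with hu
  have hu1 : ‖u‖ = 1 := by
    rw [hu, norm_div, norm_mul, hs1, one_mul, Complex.norm_real, norm_norm, div_self]
    exact norm_ne_zero_iff.2 ha
  have hexp : Complex.exp (Complex.I * u.arg) = u := by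
    have h := Complex.norm_mul_exp_arg_mul_I u
    rwa [hu1, Complex.ofReal_one, one_mul, mul_comm] at h
  refine ⟨s, u.arg, hs1, fun k => ?_⟩
  have e1 : Complex.exp (-(Complex.I * (-u.arg + -k))) = Complex.exp (Complex.I * k) * u := by
    nth_rw 2 [← hexp]
    rw [← Complex.exp_add]
    congr 1
    ring
  have e2 : Complex.exp (Complex.I * (-u.arg + -k)) = Complex.exp (-(Complex.I * k)) * u⁻¹ := by
    nth_rw 2 [← hexp]
    rw [← Complex.exp_neg, ← Complex.exp_add]
    congr 1
    ring
  have hc' : c = -(s * s * (starRingEnd ℂ) b) := by rw [← Complex.star_def, ← hc, neg_neg]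
  have haa' : (starRingEnd ℂ) a * a = (‖a‖ : ℂ) ^ 2 := haa
  ext i j
  fin_cases i <;> fin_cases j <;>
    simp [fourierCoin, standardCoin, R, Matrix.mul_apply, Fin.sum_univ_two, e1, e2]
  · rw [hu]
    field_simp
  · rw [hu]
    field_simp
    linear_combination (-b) * haa'
  · rw [hu, hc']
    field_simp
  · rw [hu, hd, Complex.star_def]
    field_simp
    linear_combination haa'

lemma fourierTransform_amplitude_eq {M : Matrix (Fin 2) (Fin 2) ℂ} {r : ℝ} (hr0 : 0 < r)
    (hr1 : r < 1) {q : ℂ} (hq : ‖q‖ ^ 2 = 1 - r ^ 2) {s : ℂ} {η : ℝ}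
    (hM : ∀ k, fourierCoin M (k + η) = s • standardCoin r q k) (v : Fin 2 → ℂ) (t : ℕ) (k : ℝ) :
    fourierTransform (amplitude (fun _ => M) v t) (k + η) = s ^ t • rotation r q v t k := by
  induction t with
  | zero => simp [fourierTransform_amplitude_zero, rotation]
  | succ t ih =>
    rw [fourierTransform_amplitude_succ, ih, hM, Nat.cast_succ, rotation_succ hr0 hr1 hq,
      Matrix.smul_mulVec, Matrix.mulVec_smul, smul_smul, pow_succ']

/-- Convergence of the characteristic functions of the walk with a constant coin, rescaled by
time. -/
lemma tendsto_sum_normSq_amplitude_mul_exp {a b c d : ℂ} (ha : a ≠ 0) (hb : b ≠ 0)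
    (hM : !![a, b; c, d] ∈ Matrix.unitaryGroup (Fin 2) ℂ) {v : Fin 2 → ℂ} (hv : normSq v = 1)
    (ξ : ℝ) :
    Tendsto (fun t : ℕ => ∑ x ∈ Finset.Icc (-(t : ℤ)) t,
      (normSq (amplitude (fun _ => !![a, b; c, d]) v t x) : ℂ) *
        Complex.exp ((ξ / t : ℝ) * x * Complex.I)) atTop
      (𝓝 (∫ x, (konnoDensity a x * (1 - velocityBias a b v * x)) •
        Complex.exp (ξ * x * Complex.I))) := by
  have hab := norm_sq_add_norm_sq_of_mem_unitaryGroup hM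
  have hr0 : 0 < ‖a‖ := norm_pos_iff.2 ha
  have hb0 : 0 < ‖b‖ := norm_pos_iff.2 hb
  have hr1 : ‖a‖ < 1 := by nlinarith
  obtain ⟨s, η, hs, hcoin⟩ := exists_fourierCoin_eq_smul_standardCoin ha hM
  set q := star a * b / ‖a‖ with hqdef
  have hq : ‖q‖ ^ 2 = 1 - ‖a‖ ^ 2 := by
    rw [hqdef, norm_div, norm_mul, norm_star, Complex.norm_real, norm_norm,
      mul_div_cancel_left₀ _ hr0.ne']
    linarith
  set F : ℕ → ℝ → ℂ := fun t k =>
    star (rotation ‖a‖ q v t k) ⬝ᵥ rotation ‖a‖ q v t (k + ξ / t) with hF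
  have hFeq (t : ℕ) (k : ℝ) : F t k =
      star (fourierTransform (amplitude (fun _ => !![a, b; c, d]) v t) (k + η)) ⬝ᵥ
        fourierTransform (amplitude (fun _ => !![a, b; c, d]) v t) (k + ξ / t + η) := by
    have hst : star (s ^ t) * s ^ t = 1 := by
      rw [Complex.star_def, Complex.conj_mul', norm_pow, hs, one_pow]
      simp
    rw [fourierTransform_amplitude_eq hr0 hr1 hq hcoin,
      fourierTransform_amplitude_eq hr0 hr1 hq hcoin, star_smul, smul_dotProduct, dotProduct_smul,
      smul_smul, hst, one_smul]
  have hFc (t : ℕ) : Continuous (F t) := by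
    have hc := continuous_fourierTransform_amplitude (fun _ => !![a, b; c, d]) v t
    rw [funext (hFeq t)]
    exact (hc.comp (by fun_prop : Continuous fun k : ℝ => k + η)).star.dotProduct
      (hc.comp (by fun_prop : Continuous fun k : ℝ => k + ξ / t + η))
  have hlim : Tendsto (fun t => ∫ k in (-(Real.pi / 2))..(3 * Real.pi / 2), F t k) atTop
      (𝓝 (∫ k in (-(Real.pi / 2))..(3 * Real.pi / 2), limitIntegrand ‖a‖ q v ξ k)) := by
    refine intervalIntegral.tendsto_integral_filter_of_dominated_convergence (fun _ => 2)
      (Eventually.of_forall fun t => (hFc t).aestronglyMeasurable)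
      (Eventually.of_forall fun t => Eventually.of_forall fun k _ =>
        norm_star_rotation_dotProduct_rotation_le hr0 hr1 hq hv t k _)
      intervalIntegrable_const
      (Eventually.of_forall fun k _ =>
        tendsto_star_rotation_dotProduct_rotation hr0 hr1 hq hv ξ k)
  rw [integral_limitIntegrand ha hr1] at hlim
  have hpi : (2 * Real.pi : ℂ) ≠ 0 := by exact_mod_cast (by positivity : (2 * Real.pi) ≠ 0)
  have h2 := hlim.const_mul ((2 * Real.pi : ℂ)⁻¹)
  rw [inv_mul_cancel_left₀ hpi] at h2
  refine h2.congr fun t => ?_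
  rw [intervalIntegral.integral_congr fun k _ => hFeq t k,
    integral_star_dotProduct_fourierTransform, inv_mul_cancel_left₀ hpi]

lemma charFun_map_positionPMF (U : ℕ → Matrix.unitaryGroup (Fin 2) ℂ) (φ : Fin 2 → ℂ)
    (hφ : normSq φ = 1) (t : ℕ) (ξ : ℝ) :
    charFun ((positionPMF U φ hφ t).toMeasure.map fun x : ℤ => (x : ℝ) / (t : ℝ)) ξ =
      ∑ x ∈ Finset.Icc (-(t : ℤ)) t,
        (normSq (amplitude (fun s => (U s : Matrix (Fin 2) (Fin 2) ℂ)) φ t x) : ℂ) *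
          Complex.exp ((ξ / t : ℝ) * x * Complex.I) := by
  rw [charFun_apply_real, integral_map (measurable_of_countable _).aemeasurable
    (by fun_prop), PMF.integral_eq_tsum]
  · rw [tsum_eq_sum (s := Finset.Icc (-(t : ℤ)) t)]
    · refine Finset.sum_congr rfl fun x _ => ?_
      have h : ((positionPMF U φ hφ t) x).toReal =
          normSq (amplitude (fun s => (U s : Matrix (Fin 2) (Fin 2) ℂ)) φ t x) :=
        ENNReal.toReal_ofReal (normSq_nonneg _)
      rw [h, Complex.real_smul]
      congr 2
      push_cast
      ring
    · intro x hx
      have h : (positionPMF U φ hφ t) x = ENNReal.ofReal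
          (normSq (amplitude (fun s => (U s : Matrix (Fin 2) (Fin 2) ℂ)) φ t x)) := rfl
      rw [h, amplitude_eq_zero _ _ _ _ hx]
      simp [normSq]
  · refine Integrable.of_bound (measurable_of_countable _).aestronglyMeasurable 1
      (Eventually.of_forall fun x => ?_)
    rw [← Complex.ofReal_mul, Complex.norm_exp_ofReal_mul_I]

end QuantumWalk

open QuantumWalk in
/-- Coins `U_t = [[a e^{iw_t}, b], [c, d e^{-iw_t}]]` with `w_{t+1} + w_t = κ₁`, walker started at
the origin in the state `(α, β)`. The matrix `U = [[a, b], [c, d]]` is unitary, the walk is, up to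
the phases `e^{-iκ₁x/2} R(-w_t/2)`, the one-period walk with coin `U` started in `R(w₀/2) (α, β)`,
and `X_t / t` converges in distribution to a random variable whose density is `limitDensity`. -/
theorem theorem2 (a b c d α β : ℂ) (w : ℕ → ℝ) (κ₁ : ℝ)
    (U : ℕ → Matrix.unitaryGroup (Fin 2) ℂ)
    (hU : ∀ t, (U t : Matrix (Fin 2) (Fin 2) ℂ) =
      !![a * Complex.exp (Complex.I * w t), b; c, d * Complex.exp (-(Complex.I * w t))])
    (habcd : a * b * c * d ≠ 0)
    (hw : ∀ t, w (t + 1) + w t = κ₁)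
    (hφ : QuantumWalk.normSq ![α, β] = 1) :
    !![a, b; c, d] ∈ Matrix.unitaryGroup (Fin 2) ℂ ∧
    (∀ (t : ℕ) (x : ℤ),
      QuantumWalk.amplitude (fun s => (U s : Matrix (Fin 2) (Fin 2) ℂ)) ![α, β] t x =
        Complex.exp (-(Complex.I * κ₁ * x / 2)) •
          (QuantumWalk.R (-(w t / 2))).mulVec
            (QuantumWalk.amplitude (fun _ => !![a, b; c, d])
              ((QuantumWalk.R (w 0 / 2)).mulVec ![α, β]) t x)) ∧
    (∀ x, 0 ≤ QuantumWalk.limitDensity a b α β (w 0) x) ∧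
    ∃ μ : ProbabilityMeasure ℝ,
      (μ : Measure ℝ) = volume.withDensity
        (fun x => ENNReal.ofReal (QuantumWalk.limitDensity a b α β (w 0) x)) ∧
      TendstoInDistribution (fun (t : ℕ) (x : ℤ) => (x : ℝ) / (t : ℝ)) atTop (id : ℝ → ℝ)
        (fun t => (QuantumWalk.positionPMF U ![α, β] hφ t).toMeasure) (μ : Measure ℝ) := by
  have ha : a ≠ 0 := by rintro rfl; simp at habcd
  have hb : b ≠ 0 := by rintro rfl; simp at habcd
  have hU' (t : ℕ) : (U t : Matrix (Fin 2) (Fin 2) ℂ) =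
      R (w t / 2) * !![a, b; c, d] * R (w t / 2) := by
    rw [hU, coin_eq_R_mul_mul_R]
  have hM : !![a, b; c, d] ∈ Matrix.unitaryGroup (Fin 2) ℂ := by
    have h : !![a, b; c, d] = R (-(w 0 / 2)) * U 0 * R (-(w 0 / 2)) := by
      rw [hU', Matrix.mul_assoc, Matrix.mul_assoc, Matrix.mul_assoc, R_mul_R, add_neg_cancel,
        ← Matrix.mul_assoc, R_mul_R, neg_add_cancel, R_zero, Matrix.one_mul, Matrix.mul_one]
    rw [h]
    exact mul_mem (mul_mem (R_mem_unitaryGroup _) (U 0).2) (R_mem_unitaryGroup _)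
  have hred (t : ℕ) (x : ℤ) :
      amplitude (fun s => (U s : Matrix (Fin 2) (Fin 2) ℂ)) ![α, β] t x =
        Complex.exp (-(Complex.I * κ₁ * x / 2)) • (R (-(w t / 2))).mulVec
          (amplitude (fun _ => !![a, b; c, d]) ((R (w 0 / 2)).mulVec ![α, β]) t x) := by
    rw [funext hU', amplitude_R_mul_mul_R _ w κ₁ hw]
  set v := (R (w 0 / 2)).mulVec ![α, β] with hvdef
  have hv : normSq v = 1 := by rw [hvdef, normSq_R_mulVec, hφ]
  have hab := norm_sq_add_norm_sq_of_mem_unitaryGroup hM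
  have hr1 : ‖a‖ < 1 := by nlinarith [norm_pos_iff.2 hb, norm_pos_iff.2 ha]
  have hdens : limitDensity a b α β (w 0) =
      fun x => konnoDensity a x * (1 - velocityBias a b v * x) :=
    funext fun x => limitDensity_eq a b α β (w 0) x
  have hnonneg (x : ℝ) : 0 ≤ limitDensity a b α β (w 0) x := by
    rw [hdens]
    exact limit_factor_nonneg ha hr1 hab hv x
  have hmeas : Measurable (limitDensity a b α β (w 0)) := by
    rw [hdens]
    exact (measurable_konnoDensity a).mul (by fun_prop)
  have hnormSq (t : ℕ) (x : ℤ) :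
      normSq (amplitude (fun s => (U s : Matrix (Fin 2) (Fin 2) ℂ)) ![α, β] t x) =
        normSq (amplitude (fun _ => !![a, b; c, d]) v t x) := by
    have h1 : ‖Complex.exp (-(Complex.I * κ₁ * x / 2))‖ = 1 := by
      rw [show -(Complex.I * κ₁ * x / 2) = ((-(κ₁ * x / 2) : ℝ) : ℂ) * Complex.I by
        push_cast; ring, Complex.norm_exp_ofReal_mul_I]
    rw [hred, normSq_smul, normSq_R_mulVec, h1, one_pow, one_mul]
  have hint : Integrable (limitDensity a b α β (w 0)) := by
    rw [hdens]
    exact integrable_konnoDensity_smul ha hr1 (by fun_prop)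
  -- the characteristic functions are `1` at `0`, hence so is their limit, the total mass
  have hmass : ∫ x, limitDensity a b α β (w 0) x = 1 := by
    have h1 := tendsto_sum_normSq_amplitude_mul_exp ha hb hM hv 0
    have h2 (t : ℕ) := charFun_map_positionPMF U ![α, β] hφ t 0
    simp only [hnormSq] at h2
    simp only [← h2, charFun_zero] at h1
    have h3 (t : ℕ) : ((positionPMF U ![α, β] hφ t).toMeasure.map
        fun x : ℤ => (x : ℝ) / (t : ℝ)).real Set.univ = 1 := by
      have := Measure.isProbabilityMeasure_map (μ := (positionPMF U ![α, β] hφ t).toMeasure)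
        (measurable_of_countable fun x : ℤ => (x : ℝ) / (t : ℝ)).aemeasurable
      exact probReal_univ
    simp only [h3] at h1
    have h4 := tendsto_nhds_unique h1 tendsto_const_nhds
    simp only [Complex.ofReal_zero, zero_mul, Complex.exp_zero, Complex.real_smul, mul_one] at h4
    rw [integral_complex_ofReal, Complex.ofReal_inj] at h4
    rw [hdens, h4]
  have hprob : IsProbabilityMeasure (volume.withDensity
      fun x => ENNReal.ofReal (limitDensity a b α β (w 0) x)) := by
    refine ⟨?_⟩
    rw [withDensity_apply _ MeasurableSet.univ, Measure.restrict_univ,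
      ← ofReal_integral_eq_lintegral_ofReal hint (Eventually.of_forall hnonneg), hmass,
      ENNReal.ofReal_one]
  obtain ⟨μ, hμ⟩ : ∃ μ : ProbabilityMeasure ℝ, (μ : Measure ℝ) = volume.withDensity
      fun x => ENNReal.ofReal (limitDensity a b α β (w 0) x) := ⟨⟨_, hprob⟩, rfl⟩
  refine ⟨hM, hred, hnonneg, μ, hμ, ?_, aemeasurable_id, ?_⟩
  · exact fun t => (measurable_of_countable _).aemeasurable
  · refine ProbabilityMeasure.tendsto_iff_tendsto_charFun.2 fun ξ => ?_
    change Tendsto (fun t => charFun ((positionPMF U ![α, β] hφ t).toMeasure.map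
      fun x : ℤ => (x : ℝ) / (t : ℝ)) ξ) atTop (𝓝 (charFun ((μ : Measure ℝ).map id) ξ))
    have h1 := tendsto_sum_normSq_amplitude_mul_exp ha hb hM hv ξ
    simp only [Measure.map_id, charFun_map_positionPMF, hnormSq]
    convert h1 using 2
    rw [hμ, charFun_apply_real, integral_withDensity_eq_integral_toReal_smul (by fun_prop)
      (Eventually.of_forall fun x => ENNReal.ofReal_lt_top)]
    refine integral_congr_ae (Eventually.of_forall fun x => ?_)
    simp only [ENNReal.toReal_ofReal (hnonneg x)]
    rw [hdens]
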